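/- Let $n \ge 0$ and $w \in S_n$. Call an $n \times 2n$ matrix $M$ over a field a \emph{generic matrix of the form $M_w$} if its $(i,j)$ entry is $0$ unless $w(i) \le j \le i+n$, and the entries in the positions with $w(i) \le j \le i+n$ are algebraically independent over some subfield. Let $\mathcal{P}_w$ be the column matroid of such a matrix, i.e. the matroid on $[2n]=\{1,\dots,2n\}$ whose independent sets are the sets of indices of linearly independent columns (its bases are the $n$-subsets $I$ of $[2n]$ for which the $n\times n$ minor in columns $I$ is nonzero). For a matroid $P$, let $P^*$ be its dual, whose bases are the complements of the bases of $P$. Let $w_n^*$ be the permutation of $[2n]$ with one-line notation $(n+1)\cdots(2n)\,1\cdots n$, that is, $w_n^*(j)=j+n$ for $j\le n$ and $w_n^*(j)=j-n$ for $j>n$. Then for every permutation $w \in S_n$, the dual matroid $\mathcal{P}_w^*$ is isomorphic to $\mathcal{P}_{w^{-1}}$ via $w_n^*$: $w_n^*\,\mathcal{P}_w^* = \mathcal{P}_{w^{-1}}$. This holds for any choice of the generic matrices of the forms $M_w$ and $M_{w^{-1}}$ that define the two matroids. -/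

import Mathlib

/-- The column matroid of a matrix `M` over a field: its ground set is the set of all column
indices, and a set of column indices is independent when the corresponding columns of `M` are
linearly independent. -/
def columnMatroid {K : Type*} [Field K] {m κ : Type*} [Finite κ] (M : Matrix m κ K) : Matroid κ :=
  (IndepMatroid.ofFinite (E := Set.univ) Set.finite_univ
    (fun I => LinearIndepOn K M.col I)
    (linearIndepOn_empty K M.col)
    (fun _ _ hJ hIJ => hJ.mono hIJ)
    (fun I J hI hJ hlt => by
      by_contra! hcon
      have hspan : ∀ e ∈ J, M.col e ∈ Submodule.span K (M.col '' I) := by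
        intro e he
        by_cases heI : e ∈ I
        · exact Submodule.subset_span ⟨e, heI, rfl⟩
        · by_contra hne
          exact hcon e he heI (hI.insert hne)
      have hfI : (M.col '' I).Finite := (Set.toFinite I).image _
      have : FiniteDimensional K (Submodule.span K (M.col '' I)) :=
        FiniteDimensional.span_of_finite K hfI
      have hle : Submodule.span K (M.col '' J) ≤ Submodule.span K (M.col '' I) := by
        rw [Submodule.span_le]
        rintro _ ⟨e, he, rfl⟩
        exact hspan e he
      have key : ∀ A : Set κ, LinearIndepOn K M.col A →
          Module.finrank K (Submodule.span K (M.col '' A)) = A.ncard := by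
        intro A hA
        have : Fintype A := Fintype.ofFinite A
        have h := finrank_span_eq_card hA
        rw [← Set.image_eq_range] at h
        rw [h, ← Nat.card_eq_fintype_card, Nat.card_coe_set_eq]
      have := Submodule.finrank_mono hle
      rw [key I hI, key J hJ] at this
      omega)
    (fun I _ => Set.subset_univ I)).matroid

/-- The positions `(i, j)` of the `n × 2n` matrix `M_w` that carry a nonzero entry. Rows and
columns are numbered from `0`; with numbering from `1` this is the condition
`w(i) ≤ j ≤ i + n`. -/
def intervalSupport {n : ℕ} (w : Equiv.Perm (Fin n)) : Set (Fin n × Fin (2 * n)) :=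
  {p | (w p.1 : ℕ) ≤ (p.2 : ℕ) ∧ (p.2 : ℕ) ≤ (p.1 : ℕ) + n}

/-- `M` is a generic matrix of the form `M_w`: its entries vanish outside the prescribed
positions, and the entries in the prescribed positions are algebraically independent over `F`
(in particular they are nonzero). -/
structure IsGenericIntervalMatrix (F : Type*) {K : Type*} [Field F] [Field K] [Algebra F K]
    {n : ℕ} (w : Equiv.Perm (Fin n)) (M : Matrix (Fin n) (Fin (2 * n)) K) : Prop where
  eq_zero : ∀ i j, (i, j) ∉ intervalSupport w → M i j = 0
  algebraicIndependent :
    AlgebraicIndependent F (fun p : intervalSupport w => M p.1.1 p.1.2)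

/-- Generic matrices of the form `M_w` exist: take distinct indeterminates as entries. -/
theorem exists_isGenericIntervalMatrix (F : Type*) [Field F] {n : ℕ} (w : Equiv.Perm (Fin n)) :
    ∃ M : Matrix (Fin n) (Fin (2 * n)) (FractionRing (MvPolynomial (Fin n × Fin (2 * n)) F)),
      IsGenericIntervalMatrix F w M := by
  classical
  refine ⟨fun i j => if (i, j) ∈ intervalSupport w then
    algebraMap (MvPolynomial (Fin n × Fin (2 * n)) F) _ (MvPolynomial.X (i, j)) else 0, ?_, ?_⟩
  · intro i j h
    simp [h]
  · have h1 : AlgebraicIndependent F (fun p : Fin n × Fin (2 * n) =>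
        algebraMap (MvPolynomial (Fin n × Fin (2 * n)) F)
          (FractionRing (MvPolynomial (Fin n × Fin (2 * n)) F)) (MvPolynomial.X p)) :=
      (MvPolynomial.algebraicIndependent_X (Fin n × Fin (2 * n)) F).map'
        (f := IsScalarTower.toAlgHom F (MvPolynomial (Fin n × Fin (2 * n)) F)
          (FractionRing (MvPolynomial (Fin n × Fin (2 * n)) F)))
        (IsFractionRing.injective _ _)
    have h2 := h1.comp (Subtype.val : intervalSupport w → _) Subtype.val_injective
    convert h2 using 1
    · funext p
      simp
    · rfl

/-- The permutation of the `2n` columns with one-line notation `(n+1) ⋯ (2n) 1 ⋯ n`, which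
exchanges the first `n` columns with the last `n` columns in order. -/
def halfSwap (n : ℕ) : Equiv.Perm (Fin (2 * n)) where
  toFun j := if h : (j : ℕ) < n then ⟨j + n, by omega⟩ else ⟨j - n, by omega⟩
  invFun j := if h : (j : ℕ) < n then ⟨j + n, by omega⟩ else ⟨j - n, by omega⟩
  left_inv j := by
    ext
    have hj := j.isLt
    dsimp only
    by_cases h : (j : ℕ) < n
    · simp [h]
    · have h' : (j : ℕ) - n < n := by omega
      simp only [h, h', dif_pos, dif_neg, not_false_eq_true]
      omega
  right_inv j := by
    ext
    have hj := j.isLt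
    dsimp only
    by_cases h : (j : ℕ) < n
    · simp [h]
    · have h' : (j : ℕ) - n < n := by omega
      simp only [h, h', dif_pos, dif_neg, not_false_eq_true]
      omega

/-! A maximal minor of a generic matrix is nonzero exactly when its columns can be matched with the
rows inside the support (`IsGenericIntervalMatrix.isBase_iff`), so the matroid depends only on `w`.
It remains to send complements of transversals to transversals. Linear duality does this: the
orthogonal complement of the row space of `M` is spanned by a matrix whose support, after exchanging
the halves, is that of `w⁻¹`, because inverses of triangular matrices are triangular
(`exists_dual_interval_matrix`). This matrix need not be generic: a nonzero minor already yields a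
matching. -/

/-- `I` is a transversal of the family of supports of the rows of `M_w`: its elements can be
matched bijectively with the rows. -/
def IsIntervalTransversal {n : ℕ} (w : Equiv.Perm (Fin n)) (I : Set (Fin (2 * n))) : Prop :=
  ∃ e : Fin n → Fin (2 * n), Function.Injective e ∧ Set.range e = I ∧
    ∀ i, (i, e i) ∈ intervalSupport w

/-! ### Maximal minors and matchings -/

theorem exists_injective_range_eq {κ : Type*} [Finite κ] {n : ℕ} {I : Set κ}
    (hI : I.ncard = n) : ∃ e : Fin n → κ, Function.Injective e ∧ Set.range e = I := by
  let e := (Finite.equivFinOfCardEq (α := I) hI).symm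
  refine ⟨Subtype.val ∘ e, Subtype.val_injective.comp e.injective, ?_⟩
  rw [e.surjective.range_comp, Subtype.range_coe]

theorem columnMatroid_indep_iff {K : Type*} [Field K] {m κ : Type*} [Finite κ]
    (M : Matrix m κ K) (I : Set κ) :
    (columnMatroid M).Indep I ↔ LinearIndepOn K M.col I := by
  simp [columnMatroid]

theorem columnMatroid_indep_range_iff {K : Type*} [Field K] {m κ : Type*} [Finite κ]
    [Fintype m] [DecidableEq m] (M : Matrix m κ K) {e : m → κ} (he : Function.Injective e) :
    (columnMatroid M).Indep (Set.range e) ↔ (M.submatrix id e).det ≠ 0 := by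
  rw [columnMatroid_indep_iff, linearIndepOn_range_iff he, ← isUnit_iff_ne_zero,
    ← Matrix.isUnit_iff_isUnit_det, ← Matrix.linearIndependent_cols_iff_isUnit]
  rfl

/-- Some Leibniz term is nonzero, and its permutation is the matching. Genericity is not assumed, so
this applies to the dual matrix too. -/
theorem isIntervalTransversal_of_det_ne_zero {K : Type*} [Field K] {n : ℕ}
    {w : Equiv.Perm (Fin n)} {M : Matrix (Fin n) (Fin (2 * n)) K}
    (hM : ∀ i j, (i, j) ∉ intervalSupport w → M i j = 0)
    {e : Fin n → Fin (2 * n)} (he : Function.Injective e) (hdet : (M.submatrix id e).det ≠ 0) :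
    IsIntervalTransversal w (Set.range e) := by
  rw [Matrix.det_apply] at hdet
  obtain ⟨σ, -, hσ⟩ := Finset.exists_ne_zero_of_sum_ne_zero hdet
  have hprod : ∏ i, (M.submatrix id e) (σ i) i ≠ 0 := fun h => hσ (by rw [h, smul_zero])
  refine ⟨e ∘ σ.symm, he.comp σ.symm.injective, σ.symm.surjective.range_comp e, fun i => ?_⟩
  by_contra hi
  refine Finset.prod_ne_zero_iff.1 hprod (σ.symm i) (Finset.mem_univ _) ?_
  simpa using hM _ _ hi

theorem IsGenericIntervalMatrix.det_ne_zero {F K : Type*} [Field F] [Field K] [Algebra F K]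
    {n : ℕ} {w : Equiv.Perm (Fin n)} {M : Matrix (Fin n) (Fin (2 * n)) K}
    (hM : IsGenericIntervalMatrix F w M) {e : Fin n → Fin (2 * n)} (he : Function.Injective e)
    (hsupp : ∀ i, (i, e i) ∈ intervalSupport w) : (M.submatrix id e).det ≠ 0 := by
  classical
  let Q : Matrix (Fin n) (Fin n) (MvPolynomial (intervalSupport w) F) := fun i k =>
    if h : (i, e k) ∈ intervalSupport w then MvPolynomial.X ⟨(i, e k), h⟩ else 0
  have hQM : M.submatrix id e = (MvPolynomial.aeval
      (fun p : intervalSupport w => M p.1.1 p.1.2)).mapMatrix Q := by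
    ext i k
    change M i (e k) = MvPolynomial.aeval _ (Q i k)
    by_cases h : (i, e k) ∈ intervalSupport w
    · simp [Q, h]
    · simp [Q, h, hM.eq_zero _ _ h]
  -- Setting the matched variables to 1 and all others to 0 gives the identity matrix, so the
  -- determinant is a nonzero polynomial.
  have hQ1 : (MvPolynomial.aeval
      (fun p : intervalSupport w => if e p.1.1 = p.1.2 then (1 : F) else 0)).mapMatrix Q = 1 := by
    ext i k
    change MvPolynomial.aeval _ (Q i k) = _
    by_cases h : (i, e k) ∈ intervalSupport w
    · simp [Q, h, Matrix.one_apply, he.eq_iff]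
    · have hik : i ≠ k := by
        rintro rfl
        exact h (hsupp i)
      simp [Q, h, hik]
  have hQ : Q.det ≠ 0 := by
    intro h0
    have h1 := congrArg Matrix.det hQ1
    rw [← AlgHom.map_det, h0, map_zero, Matrix.det_one] at h1
    exact zero_ne_one h1
  rw [hQM, ← AlgHom.map_det]
  exact fun h0 => hQ (hM.algebraicIndependent (h0.trans (map_zero _).symm))

/-! ### The two halves of the columns -/

/-- The embedding of the index set of the first `n` columns. -/
def leftColumn {n : ℕ} (j : Fin n) : Fin (2 * n) := ⟨j, by omega⟩

/-- The embedding of the index set of the last `n` columns. -/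
def rightColumn {n : ℕ} (j : Fin n) : Fin (2 * n) := ⟨j + n, by omega⟩

theorem leftColumn_injective {n : ℕ} : Function.Injective (leftColumn (n := n)) := by
  intro a b h
  simpa [leftColumn, Fin.ext_iff] using h

theorem rightColumn_injective {n : ℕ} : Function.Injective (rightColumn (n := n)) := by
  intro a b h
  simpa [rightColumn, Fin.ext_iff] using h

theorem eq_leftColumn_or_eq_rightColumn {n : ℕ} (j : Fin (2 * n)) :
    (∃ k, j = leftColumn k) ∨ ∃ k, j = rightColumn k := by
  by_cases h : (j : ℕ) < n
  · exact Or.inl ⟨⟨j, h⟩, rfl⟩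
  · exact Or.inr ⟨⟨j - n, by omega⟩, by ext; simp only [rightColumn]; omega⟩

@[simp]
theorem halfSwap_leftColumn {n : ℕ} (j : Fin n) : halfSwap n (leftColumn j) = rightColumn j := by
  simp [halfSwap, leftColumn, rightColumn]

@[simp]
theorem halfSwap_rightColumn {n : ℕ} (j : Fin n) : halfSwap n (rightColumn j) = leftColumn j := by
  simp [halfSwap, leftColumn, rightColumn]

theorem halfSwap_halfSwap {n : ℕ} (j : Fin (2 * n)) : halfSwap n (halfSwap n j) = j :=
  (halfSwap n).left_inv j

theorem leftColumn_mem_intervalSupport {n : ℕ} {w : Equiv.Perm (Fin n)} {i j : Fin n} :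
    (i, leftColumn j) ∈ intervalSupport w ↔ w i ≤ j := by
  simp only [intervalSupport, leftColumn, Set.mem_ofPred_eq, Fin.le_def]
  omega

theorem rightColumn_mem_intervalSupport {n : ℕ} {w : Equiv.Perm (Fin n)} {i j : Fin n} :
    (i, rightColumn j) ∈ intervalSupport w ↔ j ≤ i := by
  simp only [intervalSupport, rightColumn, Set.mem_ofPred_eq, Fin.le_def]
  omega

theorem sum_eq_sum_leftColumn_add_sum_rightColumn {K : Type*} [AddCommMonoid K] {n : ℕ}
    (f : Fin (2 * n) → K) :
    ∑ j, f j = ∑ j : Fin n, f (leftColumn j) + ∑ j : Fin n, f (rightColumn j) := by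
  rw [← Fintype.sum_sumElim, ← (Equiv.ofBijective (Sum.elim leftColumn rightColumn) ?_).sum_comp]
  · exact Finset.sum_congr rfl fun x _ => by cases x <;> rfl
  · refine ⟨leftColumn_injective.sumElim rightColumn_injective fun a b h => ?_, fun j => ?_⟩
    · simp only [leftColumn, rightColumn, Fin.ext_iff] at h
      omega
    · rcases eq_leftColumn_or_eq_rightColumn j with ⟨k, rfl⟩ | ⟨k, rfl⟩
      · exact ⟨Sum.inl k, rfl⟩
      · exact ⟨Sum.inr k, rfl⟩

theorem IsGenericIntervalMatrix.isBase_iff {F K : Type*} [Field F] [Field K] [Algebra F K]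
    {n : ℕ} {w : Equiv.Perm (Fin n)} {M : Matrix (Fin n) (Fin (2 * n)) K}
    (hM : IsGenericIntervalMatrix F w M) (I : Set (Fin (2 * n))) :
    (columnMatroid M).IsBase I ↔ IsIntervalTransversal w I := by
  have hindep : ∀ {e : Fin n → Fin (2 * n)}, Function.Injective e →
      (∀ i, (i, e i) ∈ intervalSupport w) → (columnMatroid M).Indep (Set.range e) :=
    fun he h => (columnMatroid_indep_range_iff M he).2 (hM.det_ne_zero he h)
  have hcard : ∀ J, (columnMatroid M).Indep J → J.ncard ≤ n := by
    intro J hJ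
    have : Fintype J := Fintype.ofFinite J
    have h := LinearIndependent.fintype_card_le_finrank ((columnMatroid_indep_iff M J).1 hJ)
    rwa [Module.finrank_fin_fun, ← Nat.card_eq_fintype_card, Nat.card_coe_set_eq] at h
  have hbase : ∀ {e : Fin n → Fin (2 * n)}, Function.Injective e →
      (∀ i, (i, e i) ∈ intervalSupport w) → (columnMatroid M).IsBase (Set.range e) := by
    intro e he h
    obtain ⟨J, hJ, hIJ⟩ := (hindep he h).exists_isBase_superset
    have heq : Set.range e = J := Set.eq_of_subset_of_ncard_le hIJ
      (by rw [Set.ncard_range_of_injective he, Nat.card_fin]; exact hcard J hJ.indep)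
      (Set.toFinite _)
    rwa [heq]
  constructor
  · intro hI
    -- The last `n` columns are matched along the diagonal, so the rank is exactly `n`.
    have hR := hbase (rightColumn_injective (n := n))
      (fun i => rightColumn_mem_intervalSupport.2 le_rfl)
    have hIn : I.ncard = n := by
      rw [hI.ncard_eq_ncard_of_isBase hR, Set.ncard_range_of_injective rightColumn_injective,
        Nat.card_fin]
    obtain ⟨e, he, rfl⟩ := exists_injective_range_eq hIn
    exact isIntervalTransversal_of_det_ne_zero hM.eq_zero he
      ((columnMatroid_indep_range_iff M he).1 hI.indep)
  · rintro ⟨e, he, rfl, h⟩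
    exact hbase he h

/-! ### Duality -/

/-- Writing `M = [A | B]` with `A` the row permutation of an upper triangular matrix and `B` lower
triangular, the orthogonal complement of the row space of `M` is spanned, after exchanging the two
halves of the columns, by the rows of a matrix of the form `M_{w⁻¹}`. -/
theorem exists_dual_interval_matrix {K : Type*} [Field K] {n : ℕ} {w : Equiv.Perm (Fin n)}
    {M : Matrix (Fin n) (Fin (2 * n)) K}
    (hM : ∀ i j, (i, j) ∉ intervalSupport w → M i j = 0)
    (hA : (M.submatrix id (leftColumn ∘ w)).det ≠ 0)
    (hB : (M.submatrix id rightColumn).det ≠ 0) :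
    ∃ N : Matrix (Fin n) (Fin (2 * n)) K,
      (∀ i j, (i, j) ∉ intervalSupport w⁻¹ → N i j = 0) ∧
      ∀ x, (N.submatrix id (halfSwap n)).mulVec x = 0 → ∃ y, x = M.transpose.mulVec y := by
  let U : Matrix (Fin n) (Fin n) K := M.submatrix w.symm leftColumn
  let B : Matrix (Fin n) (Fin n) K := M.submatrix id rightColumn
  have hU : U.det ≠ 0 := by
    rw [← Matrix.det_submatrix_equiv_self w]
    convert hA using 2
    ext i j
    simp [U]
  have hUu : IsUnit U.det := isUnit_iff_ne_zero.2 hU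
  have hBu : IsUnit B.det := isUnit_iff_ne_zero.2 hB
  have hUt : U.BlockTriangular id := by
    intro i j hij
    refine hM _ _ fun h => ?_
    rw [leftColumn_mem_intervalSupport, Equiv.apply_symm_apply] at h
    exact absurd hij (not_lt.2 h)
  have hBt : B.BlockTriangular OrderDual.toDual := by
    intro i j hij
    refine hM _ _ fun h => ?_
    rw [id, rightColumn_mem_intervalSupport] at h
    exact absurd (OrderDual.toDual_lt_toDual.1 hij) (not_lt.2 h)
  let := U.invertibleOfIsUnitDet hUu
  let := B.invertibleOfIsUnitDet hBu
  have hUi := Matrix.blockTriangular_inv_of_blockTriangular hUt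
  have hBi := Matrix.blockTriangular_inv_of_blockTriangular hBt
  -- The left block is the transpose of `B⁻¹` with rows permuted by `w`, the right block minus the
  -- transpose of `U⁻¹`.
  let N : Matrix (Fin n) (Fin (2 * n)) K := fun r j =>
    if h : (j : ℕ) < n then B⁻¹ ⟨j, h⟩ (w.symm r) else -U⁻¹ ⟨j - n, by omega⟩ r
  have hNl : ∀ r k, N r (leftColumn k) = B⁻¹ k (w.symm r) := fun r k => by
    simp [N, leftColumn]
  have hNr : ∀ r k, N r (rightColumn k) = -U⁻¹ k r := fun r k => by
    simp [N, rightColumn]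
  refine ⟨N, fun i j hij => ?_, fun x hx => ?_⟩
  · rcases eq_leftColumn_or_eq_rightColumn j with ⟨k, rfl⟩ | ⟨k, rfl⟩
    · rw [leftColumn_mem_intervalSupport, not_le] at hij
      rw [hNl]
      exact hBi (OrderDual.toDual_lt_toDual.2 hij)
    · rw [rightColumn_mem_intervalSupport, not_le] at hij
      rw [hNr, hUi hij, neg_zero]
  -- The right half of `x` determines `y`; the kernel equation says that the left half determines
  -- the same `y`, up to `w`.
  · let y := (B⁻¹).transpose.mulVec (x ∘ rightColumn)
    have hB' : B.transpose.mulVec y = x ∘ rightColumn := by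
      rw [Matrix.mulVec_mulVec, ← Matrix.transpose_mul, Matrix.nonsing_inv_mul _ hBu,
        Matrix.transpose_one, Matrix.one_mulVec]
    have hy : y ∘ w.symm = (U⁻¹).transpose.mulVec (x ∘ leftColumn) := by
      funext r
      have h := congrFun hx r
      simp only [Matrix.mulVec, dotProduct, Matrix.submatrix_apply, id,
        sum_eq_sum_leftColumn_add_sum_rightColumn (n := n), halfSwap_leftColumn,
        halfSwap_rightColumn, hNl, hNr, neg_mul, Finset.sum_neg_distrib, Pi.zero_apply] at h
      exact (neg_add_eq_zero.1 h).symm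
    have hU' : U.transpose.mulVec (y ∘ w.symm) = x ∘ leftColumn := by
      rw [hy, Matrix.mulVec_mulVec, ← Matrix.transpose_mul, Matrix.nonsing_inv_mul _ hUu,
        Matrix.transpose_one, Matrix.one_mulVec]
    refine ⟨y, funext fun j => ?_⟩
    rcases eq_leftColumn_or_eq_rightColumn j with ⟨k, rfl⟩ | ⟨k, rfl⟩
    · rw [← Function.comp_apply (f := x), ← hU']
      exact w.symm.sum_comp fun i => M i (leftColumn k) * y i
    · rw [← Function.comp_apply (f := x), ← hB']
      rfl

/-- If the complementary minor of `N` vanished, a nonzero vector supported on `Iᶜ` would lie in the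
row space of `M`. It vanishes on `I`, where the minor of `M` is nonzero, so it would be zero. -/
theorem IsIntervalTransversal.halfSwap_image_compl {n : ℕ} {w : Equiv.Perm (Fin n)}
    {I : Set (Fin (2 * n))} (hI : IsIntervalTransversal w I) :
    IsIntervalTransversal w⁻¹ (halfSwap n '' Iᶜ) := by
  obtain ⟨M, hM⟩ := exists_isGenericIntervalMatrix (ZMod 2) w
  obtain ⟨N, hN, hNM⟩ := exists_dual_interval_matrix hM.eq_zero
    (hM.det_ne_zero (leftColumn_injective.comp w.injective)
      fun _ => leftColumn_mem_intervalSupport.2 le_rfl)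
    (hM.det_ne_zero rightColumn_injective fun _ => rightColumn_mem_intervalSupport.2 le_rfl)
  obtain ⟨e, he, rfl, hsupp⟩ := hI
  have hdet := hM.det_ne_zero he hsupp
  have hcard : (Set.range e)ᶜ.ncard = n := by
    rw [Set.ncard_compl, Set.ncard_range_of_injective he, Nat.card_fin, Nat.card_fin]
    omega
  obtain ⟨f, hf, hfr⟩ := exists_injective_range_eq hcard
  rw [← hfr, ← Set.range_comp]
  refine isIntervalTransversal_of_det_ne_zero hN ((halfSwap n).injective.comp hf) fun h0 => ?_
  obtain ⟨v, hv, hNv⟩ := Matrix.exists_mulVec_eq_zero_iff.2 h0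
  have hx : (N.submatrix id (halfSwap n)).mulVec (Function.extend f v 0) = 0 := by
    rw [← hNv]
    funext r
    simp only [Matrix.mulVec, dotProduct]
    refine (Fintype.sum_of_injective f hf _ _ (fun j hj => ?_) fun i => ?_).symm
    · rw [Function.extend_apply' _ _ _ hj, Pi.zero_apply, mul_zero]
    · rw [hf.extend_apply]
      rfl
  obtain ⟨y, hy⟩ := hNM _ hx
  have hy0 : y = 0 := by
    refine Matrix.eq_zero_of_mulVec_eq_zero (M := (M.submatrix id e).transpose)
      (by rwa [Matrix.det_transpose]) (funext fun i => ?_)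
    have hei : ¬ ∃ a, f a = e i := by
      have : e i ∉ (Set.range e)ᶜ := fun h => h ⟨i, rfl⟩
      rwa [← hfr] at this
    have h := congrFun hy (e i)
    rw [Function.extend_apply' _ _ _ hei] at h
    exact h.symm
  refine hv (funext fun i => ?_)
  rw [← hf.extend_apply v 0 i, hy, hy0, Matrix.mulVec_zero, Pi.zero_apply, Pi.zero_apply]

open scoped Matroid in
theorem mainTheorem7 (n : ℕ) (w : Equiv.Perm (Fin n))
    {F K : Type*} [Field F] [Field K] [Algebra F K]
    {F' K' : Type*} [Field F'] [Field K'] [Algebra F' K']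
    (M : Matrix (Fin n) (Fin (2 * n)) K) (hM : IsGenericIntervalMatrix F w M)
    (N : Matrix (Fin n) (Fin (2 * n)) K') (hN : IsGenericIntervalMatrix F' w⁻¹ N) :
    (columnMatroid M)✶.mapEquiv (halfSwap n) = columnMatroid N := by
  have hswap : ∀ J : Set (Fin (2 * n)), (halfSwap n).symm '' J = halfSwap n '' J := fun _ => rfl
  have hinv : ∀ J : Set (Fin (2 * n)), halfSwap n '' (halfSwap n '' J) = J := fun J => by
    simp [Set.image_image, halfSwap_halfSwap]
  refine Matroid.ext_isBase (by simp [columnMatroid]) fun J _ => ?_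
  rw [Matroid.mapEquiv_isBase_iff, hswap, Matroid.dual_isBase_iff', hN.isBase_iff]
  have hE : (columnMatroid M).E = Set.univ := rfl
  rw [hE, ← Set.compl_eq_univ_sdiff, hM.isBase_iff]
  constructor
  · rintro ⟨h, -⟩
    have h' := h.halfSwap_image_compl
    rwa [compl_compl, hinv] at h'
  -- The converse is the same implication for `w⁻¹`, since `halfSwap` is an involution.
  · intro h
    have h' := h.halfSwap_image_compl
    rw [inv_inv, Set.image_compl_eq (halfSwap n).bijective] at h'
    exact ⟨h', Set.subset_univ _⟩
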